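/- Notation. $w^*$ is the complex conjugate of $w\in\mathbb C$ (and ${}^*$ the conjugate transpose of a matrix), $\mathbb C^d[z]$ is the space of $d\times 1$ vector polynomials. Let $\mathfrak B\subseteq\mathbb C^d[z]$ be a finite dimensional Pontryagin space, i.e. a finite dimensional subspace with a nondegenerate Hermitian form $[\cdot,\cdot]$, linear in the first argument. Let $S_{\mathfrak B}=\{\{f,g\}: f,g\in\mathfrak B,\ g(z)=zf(z)\}$ be (the graph of) multiplication by the independent variable, and $E_\alpha f=f(\alpha)$. The adjoint of a linear relation $S\subseteq\mathfrak B\times\mathfrak B$ is $S^*=\{\{h,k\}:[g,h]=[f,k]\text{ for all }\{f,g\}\in S\}$, and its defect numbers are the dimensions of $\ker(S^*-z)=\{f:\{f,zf\}\in S^*\}$ for $z$ in the upper and lower half plane. A $Q$-function for $S_{\mathfrak B}$, when the defect numbers both equal $l$, is obtained as follows. Let $A=A^*\supseteq S_{\mathfrak B}$ be a self-adjoint (possibly multi-valued) linear relation in $\mathfrak B$ with nonempty resolvent set $\rho(A)$, let $\mu\in\rho(A)\setminus\mathbb R$, let $\Gamma_\mu$ be a linear bijection of $\mathbb C^l$ onto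 $\ker(S_{\mathfrak B}^*-\mu)$, and $\Gamma_z=(I+(z-\mu)(A-z)^{-1})\Gamma_\mu$ for $z\in\rho(A)$. Then $Q$ is any $l\times l$ matrix function on $\rho(A)$ with $$\frac{Q(z)-Q(w)^*}{z-w^*}=\Gamma_w^*\Gamma_z,\qquad z,w\in\rho(A)$$ (for $z=w^*$ this means $Q(z)=Q(w)^*$), where $\Gamma_w^*:\mathfrak B\to\mathbb C^l$ is the adjoint of $\Gamma_w$. The reproducing kernel Pontryagin space of $\mathbb C^l$-valued functions on $\rho(A)$ with kernel $\Gamma_w^*\Gamma_z$ is denoted by $\mathcal L(Q)$. **Theorem 5.1.** Suppose that (A) $S_{\mathfrak B}$ is symmetric, i.e. $S_{\mathfrak B}\subseteq S_{\mathfrak B}^*$, and (B) for some $\alpha\in\mathbb C$, $\operatorname{ran}(S_{\mathfrak B}-\alpha)=\mathfrak B\cap\ker E_\alpha$. Then the defect numbers of $S_{\mathfrak B}$ are equal, for each half plane they do not depend on the point $z$, and their common value $l$ satisfies $l\le d$, and $l\ge 1$ if $\mathfrak B\ne\{0\}$. For every $l\times l$ $Q$-function $Q(z)$ for $S_{\mathfrak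 B}$, with associated pair $\{A,\Gamma_z\}$, there are $d\times d$ matrix polynomials $N(z)$ and $M(z)$ with $\det N(z)\not\equiv 0$ such that * $M(z)=N(z)\,\mathrm{diag}(Q(z),0)$ for all $z\in\rho(A)$; * $\mathfrak B=N(\mathcal L(Q)\oplus\{0\})$, in the sense that multiplication by $N(z)$ is a unitary (linear, bijective, form-preserving) map from $\mathcal L(Q)\oplus\{0\}$ onto $\mathfrak B$; * $\{M(z),N(z)\}$ is a (generalized) Nevanlinna pair of matrix polynomials: $M(z)N(z^*)^*-N(z)M(z^*)^*=0$ for all $z\in\mathbb C$, $\operatorname{rank}[M(z)\ N(z)]=d$ for at least one $z\in\mathbb C$, and the kernel $$K_{M,N}(z,w)=\frac{M(z)N(w)^*-N(z)M(w)^*}{z-w^*},\qquad z\neq w^*,$$ has $\kappa$ negative squares, where $\kappa$ is the negative index of $\mathfrak B$ (the largest dimension of a negative subspace); that is, $\kappa$ is the maximum of the numbers of negative eigenvalues, counted with multiplicity, of the Hermitian matrices $[x_j^*K_{M,N}(z_j,z_i)x_i]_{i,j=1}^n$ with $x_i\in\mathbb C^d$, $z_i\in\mathbb C$ and $z_i\ne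 z_j^*$ for all $i,j$; * $K_{M,N}(z,w)$ is the reproducing kernel of $\mathfrak B$: the reproducing kernel $K(z,w)$ of $\mathfrak B$ exists and equals $K_{M,N}(z,w)$ whenever $z\ne w^*$. -/

import Mathlib

open Polynomial
open scoped ComplexConjugate Matrix

namespace PolyPontryagin

/-! ### Finite dimensional Pontryagin spaces and linear relations -/

section Relations

variable {K : Type*} [AddCommGroup K] [Module ℂ K]

/-- `φ f g = [f, g]` is linear in `f` and conjugate linear in `g`. A finite dimensional Pontryagin
space is a finite dimensional space with a nondegenerate Hermitian form. -/
structure IsPontryaginForm (φ : K →ₗ[ℂ] K →ₗ⋆[ℂ] ℂ) : Prop where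
  hermitian : ∀ f g, conj (φ f g) = φ g f
  nondegenerate : ∀ f, (∀ g, φ f g = 0) → f = 0

/-- `κ` is the negative index: the largest dimension of a negative subspace. -/
def HasNegativeIndex (φ : K →ₗ[ℂ] K →ₗ⋆[ℂ] ℂ) (κ : ℕ) : Prop :=
  IsGreatest {m : ℕ | ∃ W : Submodule ℂ K, FiniteDimensional ℂ W ∧ Module.finrank ℂ W = m ∧
    ∀ f ∈ W, f ≠ 0 → (φ f f).re < 0} κ

/-- The adjoint `{ {h, k} : [g, h] = [f, k] for all {f, g} ∈ S }` of a linear relation `S`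
(a subspace of `K × K`). -/
def adjointRel (φ : K →ₗ[ℂ] K →ₗ⋆[ℂ] ℂ) (S : Submodule ℂ (K × K)) : Submodule ℂ (K × K) where
  carrier := {q | ∀ p ∈ S, φ p.2 q.1 = φ p.1 q.2}
  add_mem' := by
    intro a b ha hb p hp
    simp [ha p hp, hb p hp]
  zero_mem' := by
    intro p _
    simp
  smul_mem' := by
    intro c a ha p hp
    simp [ha p hp]

/-- `S ⊆ S^*`. -/
def IsSymmetricRel (φ : K →ₗ[ℂ] K →ₗ⋆[ℂ] ℂ) (S : Submodule ℂ (K × K)) : Prop :=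
  S ≤ adjointRel φ S

/-- `A = A^*`. -/
def IsSelfAdjointRel (φ : K →ₗ[ℂ] K →ₗ⋆[ℂ] ℂ) (A : Submodule ℂ (K × K)) : Prop :=
  adjointRel φ A = A

/-- `ran (S - α) = { g - α f : {f, g} ∈ S }`. -/
def ranSub (S : Submodule ℂ (K × K)) (α : ℂ) : Submodule ℂ K :=
  S.map (LinearMap.snd ℂ K K - α • LinearMap.fst ℂ K K)

/-- The defect space `ker (S^* - z) = { f : {f, z f} ∈ S^* }`. -/
def defectSpace (φ : K →ₗ[ℂ] K →ₗ⋆[ℂ] ℂ) (S : Submodule ℂ (K × K)) (z : ℂ) : Submodule ℂ K :=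
  (adjointRel φ S).comap (LinearMap.prod LinearMap.id (z • LinearMap.id))

/-- Both defect numbers of `S` (for the upper and for the lower half plane) equal `l`. -/
def HasDefectNumbers (φ : K →ₗ[ℂ] K →ₗ⋆[ℂ] ℂ) (S : Submodule ℂ (K × K)) (l : ℕ) : Prop :=
  ∀ z : ℂ, z.im ≠ 0 → Module.finrank ℂ (defectSpace φ S z) = l

/-- The relation `(A - z)⁻¹ = { {g - z f, f} : {f, g} ∈ A }` is the graph of the everywhere defined
operator `R`. -/
def IsResolventAt (A : Submodule ℂ (K × K)) (z : ℂ) (R : K →ₗ[ℂ] K) : Prop :=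
  ∀ f g : K, (f, g) ∈ A ↔ R (g - z • f) = f

/-- The resolvent set of a relation in a finite dimensional space (every linear operator there is
bounded). -/
def resolventSet (A : Submodule ℂ (K × K)) : Set ℂ :=
  {z | ∃ R : K →ₗ[ℂ] K, IsResolventAt A z R}

/-- The matrix `Γ_w^* Γ_z`, where `Γ_w^*` is the adjoint of `Γ_w : ℂ^l → K` with respect to the
standard inner product of `ℂ^l` and the form of `K`; its entry `(i, j)` is `[Γ_z e_j, Γ_w e_i]`. -/
def defectKernel (φ : K →ₗ[ℂ] K →ₗ⋆[ℂ] ℂ) {l : ℕ} (Γ : ℂ → (Fin l → ℂ) →ₗ[ℂ] K) (z w : ℂ) :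
    Matrix (Fin l) (Fin l) ℂ :=
  Matrix.of fun i j => φ (Γ z (Pi.single j 1)) (Γ w (Pi.single i 1))

/-- `Q` is a `Q`-function for `S` associated with the pair `{A, Γ_z}`: `A` is a self-adjoint
extension of `S` (possibly multi-valued) with nonempty resolvent set, `Γ_μ` is a bijection of `ℂ^l`
onto `ker (S^* - μ)` for some nonreal `μ ∈ ρ(A)`, `Γ_z = (I + (z - μ)(A - z)⁻¹) Γ_μ` for `z ∈ ρ(A)`,
and `(Q(z) - Q(w)^*) / (z - w^*) = Γ_w^* Γ_z` on `ρ(A)`; the last identity is written without the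
quotient, so that it says `Q(z) = Q(w)^*` where `z = w^*`. The values of `Q` and `Γ` outside
`ρ(A)` are irrelevant. -/
structure IsQFunction (φ : K →ₗ[ℂ] K →ₗ⋆[ℂ] ℂ) (S : Submodule ℂ (K × K)) {l : ℕ}
    (A : Submodule ℂ (K × K)) (Γ : ℂ → (Fin l → ℂ) →ₗ[ℂ] K)
    (Q : ℂ → Matrix (Fin l) (Fin l) ℂ) : Prop where
  selfAdjoint : IsSelfAdjointRel φ A
  extends_rel : S ≤ A
  defect_maps : ∃ μ ∈ resolventSet A, μ.im ≠ 0 ∧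
    Function.Injective (Γ μ) ∧ LinearMap.range (Γ μ) = defectSpace φ S μ ∧
    ∀ z : ℂ, ∀ R : K →ₗ[ℂ] K, IsResolventAt A z R →
      Γ z = (LinearMap.id + (z - μ) • R) ∘ₗ Γ μ
  kernel_eq : ∀ z ∈ resolventSet A, ∀ w ∈ resolventSet A,
    Q z - (Q w)ᴴ = (z - conj w) • defectKernel φ Γ z w

/-- `k` is the reproducing kernel of the Pontryagin space `(K, φ)` of `ℂ^n`-valued functions on `Ω`,
`ev z` being the evaluation at `z`: for all `w` and `x` the function `k(·, w) x` belongs to the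
space and `[f, k(·, w) x] = x^* f(w)` for all `f` in it. -/
def IsReproducingKernel {Ω : Type*} {n : ℕ} (φ : K →ₗ[ℂ] K →ₗ⋆[ℂ] ℂ)
    (ev : Ω → K →ₗ[ℂ] (Fin n → ℂ)) (k : Ω → Ω → Matrix (Fin n) (Fin n) ℂ) : Prop :=
  ∀ (w : Ω) (x : Fin n → ℂ), ∃ g : K, (∀ z, ev z g = k z w *ᵥ x) ∧
    ∀ f : K, φ f g = star x ⬝ᵥ ev w f

end Relations

/-- A (finite dimensional) Pontryagin space of `ℂ^n`-valued functions on `Ω`. -/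
structure FunctionSpace (Ω : Set ℂ) (n : ℕ) where
  carrier : Submodule ℂ (Ω → Fin n → ℂ)
  finiteDimensional : FiniteDimensional ℂ carrier
  form : carrier →ₗ[ℂ] carrier →ₗ⋆[ℂ] ℂ
  pontryagin : IsPontryaginForm form

/-- `L` is the reproducing kernel Pontryagin space with kernel `k`; it is uniquely determined by
`k`. -/
def FunctionSpace.HasKernel {Ω : Set ℂ} {n : ℕ} (L : FunctionSpace Ω n)
    (k : Ω → Ω → Matrix (Fin n) (Fin n) ℂ) : Prop :=
  IsReproducingKernel L.form (fun z => LinearMap.proj z ∘ₗ L.carrier.subtype) k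

/-! ### Vector polynomials: `ℂ^d[z]` is `Fin d → ℂ[X]` -/

section Polynomials

variable {d : ℕ}

/-- The evaluation operator `E_α : ℂ^d[z] → ℂ^d`. -/
noncomputable def evalVec (α : ℂ) : (Fin d → ℂ[X]) →ₗ[ℂ] (Fin d → ℂ) :=
  LinearMap.pi fun i => Polynomial.leval α ∘ₗ LinearMap.proj i

/-- The value of a matrix polynomial at `z`. -/
noncomputable def evalMat (M : Matrix (Fin d) (Fin d) ℂ[X]) (z : ℂ) : Matrix (Fin d) (Fin d) ℂ :=
  M.map (Polynomial.eval z)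

/-- The graph of the operator `S_𝔅` of multiplication by the independent variable:
`{ {f, g} : f, g ∈ 𝔅, g(z) = z f(z) }`. -/
noncomputable def mulRel (B : Submodule ℂ (Fin d → ℂ[X])) : Submodule ℂ (B × B) where
  carrier := {p | (p.2 : Fin d → ℂ[X]) = (X : ℂ[X]) • (p.1 : Fin d → ℂ[X])}
  add_mem' := by
    intro a b ha hb
    simp only [Set.mem_ofPred_eq] at ha hb
    simp [ha, hb]
  zero_mem' := by simp
  smul_mem' := by
    intro c a ha
    simp only [Set.mem_ofPred_eq] at ha
    simp [ha, smul_comm c]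

/-- `diag(Q, 0)`, padded by zeros to size `d × d` (used for `l ≤ d`). -/
def padMat {l : ℕ} (d : ℕ) (Q : Matrix (Fin l) (Fin l) ℂ) : Matrix (Fin d) (Fin d) ℂ :=
  Matrix.of fun i j =>
    if h : (i : ℕ) < l ∧ (j : ℕ) < l then Q ⟨i, h.1⟩ ⟨j, h.2⟩ else 0

/-- The vector `[u; 0]`, padded by zeros to length `d` (used for `l ≤ d`). -/
def padVec {l : ℕ} (d : ℕ) (u : Fin l → ℂ) : Fin d → ℂ :=
  fun i => if h : (i : ℕ) < l then u ⟨i, h⟩ else 0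

/-- `K_{M,N}(z, w) = (M(z) N(w)^* - N(z) M(w)^*) / (z - w^*)`, meaningful for `z ≠ w^*`. -/
noncomputable def nevanlinnaKernel (M N : Matrix (Fin d) (Fin d) ℂ[X]) (z w : ℂ) :
    Matrix (Fin d) (Fin d) ℂ :=
  (z - conj w)⁻¹ • (evalMat M z * (evalMat N w)ᴴ - evalMat N z * (evalMat M w)ᴴ)

/-- The matrix `[ x_j^* K_{M,N}(z_j, z_i) x_i ]_{i,j}`. -/
noncomputable def kernelGram (M N : Matrix (Fin d) (Fin d) ℂ[X]) {n : ℕ} (z : Fin n → ℂ)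
    (x : Fin n → Fin d → ℂ) : Matrix (Fin n) (Fin n) ℂ :=
  Matrix.of fun i j => star (x j) ⬝ᵥ (nevanlinnaKernel M N (z j) (z i) *ᵥ x i)

theorem nevanlinnaKernel_conjTranspose (M N : Matrix (Fin d) (Fin d) ℂ[X]) (z w : ℂ) :
    (nevanlinnaKernel M N z w)ᴴ = nevanlinnaKernel M N w z := by
  unfold nevanlinnaKernel
  rw [Matrix.conjTranspose_smul, Matrix.conjTranspose_sub, Matrix.conjTranspose_mul,
    Matrix.conjTranspose_mul, Matrix.conjTranspose_conjTranspose,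
    Matrix.conjTranspose_conjTranspose]
  have h : star ((z - conj w)⁻¹) = -(w - conj z)⁻¹ := by
    rw [← inv_neg]
    simp
  rw [h, neg_smul, ← smul_neg, neg_sub]

theorem kernelGram_isHermitian (M N : Matrix (Fin d) (Fin d) ℂ[X]) {n : ℕ} (z : Fin n → ℂ)
    (x : Fin n → Fin d → ℂ) : (kernelGram M N z x).IsHermitian := by
  ext i j
  simp only [kernelGram, Matrix.conjTranspose_apply, Matrix.of_apply]
  rw [Matrix.star_dotProduct, star_star, Matrix.star_mulVec, nevanlinnaKernel_conjTranspose,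
    ← Matrix.dotProduct_mulVec]

/-- The pair `{M, N}` and its kernel have `κ` negative squares: `κ` is the maximum of the numbers
of negative eigenvalues, counted with multiplicity, of the matrices
`[ x_j^* K_{M,N}(z_j, z_i) x_i ]` with `z_i ≠ z_j^*` for all `i, j`. -/
def HasNegativeSquares (M N : Matrix (Fin d) (Fin d) ℂ[X]) (κ : ℕ) : Prop :=
  IsGreatest {m : ℕ | ∃ (n : ℕ) (z : Fin n → ℂ) (x : Fin n → Fin d → ℂ),
    (∀ i j, z i ≠ conj (z j)) ∧
      Nat.card {i : Fin n // (kernelGram_isHermitian M N z x).eigenvalues i < 0} = m} κ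

/-- `{M, N}` is a (generalized) Nevanlinna pair of matrix polynomials with `κ` negative squares;
for `κ = 0` the word `generalized` is dropped. -/
structure IsNevanlinnaPair (M N : Matrix (Fin d) (Fin d) ℂ[X]) (κ : ℕ) : Prop where
  symm_eq : ∀ z : ℂ,
    evalMat M z * (evalMat N (conj z))ᴴ - evalMat N z * (evalMat M (conj z))ᴴ = 0
  rank_eq : ∃ z : ℂ, (Matrix.fromCols (evalMat M z) (evalMat N z)).rank = d
  negative_squares : HasNegativeSquares M N κ

end Polynomials

end PolyPontryagin

open PolyPontryagin

/-!
The space `𝔅` is identified with its model `ℒ(Q)` by the map `f ↦ (z ↦ Γ_{z^*}^* f)`, and `N` is the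
matrix that inverts this map pointwise: `f(z) = N₁(z) Γ_{z^*}^* f` for `z ∈ ρ(A)`, with `N₁` the
first `l` columns of `N`. Such an `N₁(z)` exists because `Γ_{z^*}^*` is onto and its kernel
`ker (S^* - z^*)^⊥ = ran (S - z)` is annihilated by the evaluation `E_z`.

That `N₁` is polynomial, also at the spectrum of `A`, comes from the factorization
`Γ_{z^*}^* = Γ_μ^* (I + (z - μ^*) (A - z)⁻¹)`, whose second factor has the inverse
`I - (z - μ^*) R` with `R = (A - μ^*)⁻¹` fixed. Hence `N₁(z) Γ_μ^* = E_z (I - (z - μ^*) R)`, and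
composing with a right inverse of `Γ_μ^*` shows that `N₁` is a polynomial. In the same way
`Q(z) = Q(μ)^* + (z - μ^*) Γ_μ^* Γ_z` and `(I - (z - μ^*) R) Γ_z = Γ_{μ^*}` give the polynomial
`N₁(z) Q(z) = N₁(z) Q(μ)^* + (z - μ^*) E_z Γ_{μ^*}`, the nonzero part of `M`
(`IsQFunction.exists_columns`).

Condition (B) is used through dimensions: `S - z` is injective for every `z`, so all its ranges have
the same dimension `dim 𝔅 - l`, where `l` is the rank of `E_α` (`hasDefectNumbers_mulRel`). Since
the values of `𝔅` at `α` span an `l`-dimensional space, the `l` columns of `N₁` are generically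
independent and constant columns complete them to `N` with `det N ≠ 0` (`exists_completion`).

The kernel identity `M(z) N(w)^* - N(z) M(w)^* = (z - w^*) E_z E_w^*` on `ρ(A)` follows from
`Γ_w^* Γ_z = Γ_{z^*}^* Γ_{w^*}`, and it extends to all `z`, `w` because the complement of `ρ(A)` is
finite. The matrices whose negative eigenvalues are counted are therefore Gram matrices of vectors
`E_z^* x`, and those with `z` in the upper half plane span `𝔅`; diagonalizing Gram matrices gives
the number of negative squares (`hasNegativeSquares_of_reproKernel`).
-/

namespace PolyPontryagin

/-! ### Duality in finite dimensional Pontryagin spaces -/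

section Forms

variable {K : Type*} [AddCommGroup K] [Module ℂ K] {φ : K →ₗ[ℂ] K →ₗ⋆[ℂ] ℂ}

theorem IsPontryaginForm.eq_of_forall_right (hφ : IsPontryaginForm φ) {g g' : K}
    (h : ∀ f, φ f g = φ f g') : g = g' := by
  rw [← sub_eq_zero]
  refine hφ.nondegenerate _ fun f => ?_
  rw [← hφ.hermitian, map_sub, h, sub_self, map_zero]

theorem IsPontryaginForm.flip_surjective [FiniteDimensional ℂ K] (hφ : IsPontryaginForm φ) :
    Function.Surjective φ.flip := by
  rw [← LinearMap.range_eq_top]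
  have h : (LinearMap.range φ.flip).dualCoannihilator = ⊥ := by
    rw [eq_bot_iff]
    intro f hf
    rw [Submodule.mem_dualCoannihilator] at hf
    exact hφ.nondegenerate f fun g => hf (φ.flip g) ⟨g, rfl⟩
  rw [← Subspace.dualCoannihilator_dualAnnihilator_eq (W := LinearMap.range φ.flip), h,
    Submodule.dualAnnihilator_bot]

/-- The Riesz isomorphism `g ↦ [·, g]` of a finite dimensional Pontryagin space onto its dual. -/
noncomputable def IsPontryaginForm.riesz [FiniteDimensional ℂ K] (hφ : IsPontryaginForm φ) :
    K ≃ₗ⋆[ℂ] Module.Dual ℂ K :=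
  LinearEquiv.ofBijective φ.flip
    ⟨fun _ _ h => hφ.eq_of_forall_right fun f => LinearMap.congr_fun h f, hφ.flip_surjective⟩

theorem IsPontryaginForm.apply_riesz_symm [FiniteDimensional ℂ K] (hφ : IsPontryaginForm φ)
    (ℓ : Module.Dual ℂ K) (f : K) : φ f (hφ.riesz.symm ℓ) = ℓ f :=
  LinearMap.congr_fun (hφ.riesz.apply_symm_apply ℓ) f

theorem IsPontryaginForm.exists_adjoint [FiniteDimensional ℂ K] (hφ : IsPontryaginForm φ)
    (T : K →ₗ[ℂ] K) : ∃ T' : K →ₗ[ℂ] K, ∀ f g, φ f (T' g) = φ (T f) g := by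
  refine ⟨⟨⟨fun g => hφ.riesz.symm (φ.flip g ∘ₗ T), fun g g' => ?_⟩, fun c g => ?_⟩, fun f g => ?_⟩
  · refine hφ.eq_of_forall_right fun f => ?_
    simp [hφ.apply_riesz_symm]
  · refine hφ.eq_of_forall_right fun f => ?_
    simp [hφ.apply_riesz_symm]
  · simp [hφ.apply_riesz_symm]

/-- In a finite dimensional Pontryagin space every subspace is its own biorthogonal. -/
theorem IsPontryaginForm.mem_of_orthogonal [FiniteDimensional ℂ K] (hφ : IsPontryaginForm φ)
    {W : Submodule ℂ K} {h : K} (hh : ∀ g, (∀ f ∈ W, φ f g = 0) → φ h g = 0) : h ∈ W := by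
  by_contra hW
  obtain ⟨ℓ, hℓ, hle⟩ := Submodule.exists_le_ker_of_notMem hW
  refine hℓ ?_
  rw [← hφ.apply_riesz_symm]
  refine hh _ fun f hf => ?_
  rw [hφ.apply_riesz_symm]
  exact hle hf

/-- The orthogonal complement `V` of `W` has the dimension of the annihilator of `W`. The Riesz map
between them is conjugate linear, which does not change dimensions. -/
theorem IsPontryaginForm.finrank_eq_dualAnnihilator [FiniteDimensional ℂ K]
    (hφ : IsPontryaginForm φ) {W V : Submodule ℂ K} (h : ∀ g, g ∈ V ↔ ∀ f ∈ W, φ f g = 0) :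
    Module.finrank ℂ V = Module.finrank ℂ W.dualAnnihilator := by
  have hV : V = W.dualAnnihilator.comap (hφ.riesz : K →ₛₗ[starRingEnd ℂ] Module.Dual ℂ K) := by
    ext g
    rw [h, Submodule.mem_comap, Submodule.mem_dualAnnihilator]
    rfl
  have hmap : V.map (hφ.riesz : K →ₛₗ[starRingEnd ℂ] Module.Dual ℂ K) = W.dualAnnihilator := by
    rw [hV]
    exact Submodule.map_comap_eq_of_surjective hφ.riesz.surjective _
  have e := hφ.riesz.submoduleMap V
  rw [← hmap]
  exact congrArg Cardinal.toNat (rank_eq_of_equiv_equiv (starRingEnd ℂ) e.toAddEquiv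
    (starRingAut (R := ℂ)).bijective fun r m => e.map_smulₛₗ r m)

/-- The largest dimension of a negative subspace exists in finite dimension. -/
theorem exists_hasNegativeIndex [FiniteDimensional ℂ K] (φ : K →ₗ[ℂ] K →ₗ⋆[ℂ] ℂ) :
    ∃ κ, HasNegativeIndex φ κ := by
  have hne : {m : ℕ | ∃ W : Submodule ℂ K, FiniteDimensional ℂ W ∧ Module.finrank ℂ W = m ∧
    ∀ f ∈ W, f ≠ 0 → (φ f f).re < 0}.Nonempty :=
    ⟨0, ⊥, inferInstance, finrank_bot ℂ K, fun f hf h => absurd ((Submodule.mem_bot ℂ).1 hf) h⟩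
  have hbdd : BddAbove {m : ℕ | ∃ W : Submodule ℂ K, FiniteDimensional ℂ W ∧
    Module.finrank ℂ W = m ∧ ∀ f ∈ W, f ≠ 0 → (φ f f).re < 0} := by
    refine ⟨Module.finrank ℂ K, ?_⟩
    rintro m ⟨W, -, rfl, -⟩
    exact Submodule.finrank_le W
  exact ⟨_, Nat.sSup_mem hne hbdd, fun m hm => le_csSup hbdd hm⟩

end Forms

/-! ### Negative eigenvalues of Gram matrices -/

section Gram

variable {K : Type*} [AddCommGroup K] [Module ℂ K] {φ : K →ₗ[ℂ] K →ₗ⋆[ℂ] ℂ} {n : ℕ}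
  {H : Matrix (Fin n) (Fin n) ℂ} {v : Fin n → K}

/-- The vectors `∑ i, conj (U i k) • v i`, where the columns of `U` are orthonormal eigenvectors of
`H`. When `H` is the Gram matrix of `v`, they are orthogonal and `[u k, u k]` is the `k`-th
eigenvalue. -/
noncomputable def gramDiagonal (hH : H.IsHermitian) (v : Fin n → K) (k : Fin n) : K :=
  ∑ i, conj ((hH.eigenvectorUnitary : Matrix (Fin n) (Fin n) ℂ) i k) • v i

theorem form_gramDiagonal (hH : H.IsHermitian) (hv : ∀ i j, H i j = φ (v i) (v j))
    (k m : Fin n) :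
    φ (gramDiagonal hH v k) (gramDiagonal hH v m) =
      if k = m then (hH.eigenvalues k : ℂ) else 0 := by
  have h := congrFun (congrFun hH.conjStarAlgAut_star_eigenvectorUnitary k) m
  rw [Unitary.conjStarAlgAut_star_apply, Matrix.diagonal_apply] at h
  refine Eq.trans ?_ h
  simp only [gramDiagonal, map_sum, LinearMap.sum_apply, map_smul, LinearMap.smul_apply,
    LinearMap.map_smulₛₗ, smul_eq_mul, Matrix.mul_apply, Matrix.star_apply, Finset.sum_mul,
    Complex.conj_conj, ← hv]
  refine Finset.sum_congr rfl fun j _ => ?_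
  rw [Finset.mul_sum]
  exact Finset.sum_congr rfl fun i _ => mul_comm _ _

theorem mem_span_gramDiagonal (hH : H.IsHermitian) (v : Fin n → K) (i : Fin n) :
    v i ∈ Submodule.span ℂ (Set.range (gramDiagonal hH v)) := by
  let U : Matrix (Fin n) (Fin n) ℂ := (hH.eigenvectorUnitary).1
  have hU : U * star U = 1 := Unitary.coe_mul_star_self hH.eigenvectorUnitary
  have : v i = ∑ k, U i k • gramDiagonal hH v k := by
    simp only [gramDiagonal, Finset.smul_sum, smul_smul]
    rw [Finset.sum_comm]
    simp only [← Finset.sum_smul]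
    have h : ∀ j, ∑ k, U i k * conj (U j k) = if i = j then 1 else 0 := fun j => by
      have := congrFun (congrFun hU i) j
      rwa [Matrix.mul_apply, Matrix.one_apply] at this
    simp [U] at h
    simp [U, h]
  rw [this]
  exact Submodule.sum_mem _ fun k _ => Submodule.smul_mem _ _ (Submodule.subset_span ⟨k, rfl⟩)

/-- A Gram matrix has at most as many negative eigenvalues as the negative index allows. -/
theorem HasNegativeIndex.card_neg_eigenvalues_le {κ : ℕ} (hκ : HasNegativeIndex φ κ)
    (hH : H.IsHermitian) (hv : ∀ i j, H i j = φ (v i) (v j)) :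
    Nat.card {i : Fin n // hH.eigenvalues i < 0} ≤ κ := by
  set u : {i : Fin n // hH.eigenvalues i < 0} → K := fun k => gramDiagonal hH v k
  have hu : ∀ c : {i : Fin n // hH.eigenvalues i < 0} → ℂ,
      (φ (∑ k, c k • u k) (∑ k, c k • u k)).re = ∑ k, Complex.normSq (c k) * hH.eigenvalues k := by
    intro c
    simp only [u, map_sum, LinearMap.sum_apply, map_smul, LinearMap.smul_apply,
      LinearMap.map_smulₛₗ, smul_eq_mul, form_gramDiagonal hH hv, Complex.re_sum]
    refine Finset.sum_congr rfl fun k _ => ?_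
    rw [Finset.sum_eq_single k]
    · simp [Complex.normSq_apply]; ring
    · intro b _ hb
      rw [if_neg (fun h => hb (Subtype.ext h))]
      simp
    · simp
  have hneg : ∀ c : {i : Fin n // hH.eigenvalues i < 0} → ℂ, c ≠ 0 →
      (φ (∑ k, c k • u k) (∑ k, c k • u k)).re < 0 := by
    intro c hc
    obtain ⟨k, hk⟩ := Function.ne_iff.1 hc
    rw [hu]
    refine Finset.sum_neg' (fun i _ => mul_nonpos_of_nonneg_of_nonpos (Complex.normSq_nonneg _)
      i.2.le) ⟨k, Finset.mem_univ k, mul_neg_of_pos_of_neg (Complex.normSq_pos.2 hk) k.2⟩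
  have hli : LinearIndependent ℂ u := by
    rw [Fintype.linearIndependent_iff]
    intro c hc
    by_contra! hne
    have := hneg c (Function.ne_iff.2 hne)
    rw [hc] at this
    simp at this
  refine hκ.2 ⟨Submodule.span ℂ (Set.range u),
    FiniteDimensional.span_of_finite ℂ (Set.finite_range u), ?_, ?_⟩
  · rw [finrank_span_eq_card hli, Nat.card_eq_fintype_card]
  · intro f hf hf0
    obtain ⟨c, rfl⟩ := (Submodule.mem_span_range_iff_exists_fun ℂ).1 hf
    refine hneg c fun h => hf0 ?_
    simp [h]

/-- The Gram matrix of a spanning family has at least as many negative eigenvalues as the dimension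
of any negative subspace: a vector of the subspace that is orthogonal to all negative eigenvectors
has a nonnegative square. -/
theorem HasNegativeIndex.le_card_neg_eigenvalues {κ : ℕ} (hκ : HasNegativeIndex φ κ)
    (hH : H.IsHermitian) (hv : ∀ i j, H i j = φ (v i) (v j))
    (hspan : Submodule.span ℂ (Set.range v) = ⊤) :
    κ ≤ Nat.card {i : Fin n // hH.eigenvalues i < 0} := by
  obtain ⟨W, hWfin, rfl, hW⟩ := hκ.1
  let T : W →ₗ[ℂ] ({i : Fin n // hH.eigenvalues i < 0} → ℂ) :=
    LinearMap.pi fun k => (φ.flip (gramDiagonal hH v k)) ∘ₗ W.subtype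
  have hT : Function.Injective T := by
    rw [injective_iff_map_eq_zero]
    intro f hf
    by_contra hf0
    have hlt := hW f f.2 (fun h => hf0 (Subtype.ext h))
    have hmem : (f : K) ∈ Submodule.span ℂ (Set.range (gramDiagonal hH v)) := by
      have : Submodule.span ℂ (Set.range v) ≤ Submodule.span ℂ (Set.range (gramDiagonal hH v)) :=
        Submodule.span_le.2 (by rintro _ ⟨i, rfl⟩; exact mem_span_gramDiagonal hH v i)
      exact this (hspan ▸ Submodule.mem_top)
    obtain ⟨c, hc⟩ := (Submodule.mem_span_range_iff_exists_fun ℂ).1 hmem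
    have hcoef : ∀ m, φ f (gramDiagonal hH v m) = c m * hH.eigenvalues m := by
      intro m
      rw [← hc]
      simp [form_gramDiagonal hH hv]
    have hsq : (φ f f).re = ∑ m, Complex.normSq (c m) * hH.eigenvalues m := by
      conv_lhs => rw [show φ (f : K) (f : K) = φ (f : K) (∑ m, c m • gramDiagonal hH v m) by rw [hc]]
      simp only [map_sum, LinearMap.map_smulₛₗ, smul_eq_mul, hcoef, Complex.re_sum]
      refine Finset.sum_congr rfl fun k _ => ?_
      simp [Complex.normSq_apply]; ring
    rw [hsq] at hlt
    refine absurd hlt (not_lt.2 (Finset.sum_nonneg fun m _ => ?_))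
    by_cases hm : hH.eigenvalues m < 0
    · have h0 : φ (f : K) (gramDiagonal hH v m) = 0 := congrFun hf ⟨m, hm⟩
      rw [hcoef] at h0
      rcases mul_eq_zero.1 h0 with h | h
      · simp [h]
      · exact absurd (Complex.ofReal_eq_zero.1 h) hm.ne
    · exact mul_nonneg (Complex.normSq_nonneg _) (not_lt.1 hm)
  have := LinearMap.finrank_le_finrank_of_injective hT
  rwa [Module.finrank_fintype_fun_eq_card, ← Nat.card_eq_fintype_card] at this

end Gram

/-! ### Adjoints and resolvents of linear relations -/

section Relations

variable {K : Type*} [AddCommGroup K] [Module ℂ K] {φ : K →ₗ[ℂ] K →ₗ⋆[ℂ] ℂ}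
  {S A : Submodule ℂ (K × K)}

theorem mem_ranSub {α : ℂ} {h : K} : h ∈ ranSub S α ↔ ∃ f g, (f, g) ∈ S ∧ g - α • f = h := by
  simp [ranSub, Submodule.mem_map]

/-- `ker (S^* - z)` is the orthogonal complement of `ran (S - z^*)`. -/
theorem mem_defectSpace {z : ℂ} {g : K} :
    g ∈ defectSpace φ S z ↔ ∀ f ∈ ranSub S (conj z), φ f g = 0 := by
  constructor
  · intro hg f hf
    obtain ⟨p, q, hpq, rfl⟩ := mem_ranSub.1 hf
    have : φ q g = φ p (z • g) := hg (p, q) hpq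
    simp [this]
  · intro hg p hp
    have := hg _ (mem_ranSub.2 ⟨p.1, p.2, hp, rfl⟩)
    simp only [map_sub, map_smul, LinearMap.sub_apply, LinearMap.smul_apply] at this
    simpa [sub_eq_zero] using this

/-- The dimension of `ker (S^* - z)` is the codimension of `ran (S - z^*)`. -/
theorem finrank_defectSpace_add [FiniteDimensional ℂ K] (hφ : IsPontryaginForm φ) (z : ℂ) :
    Module.finrank ℂ (ranSub S (conj z)) + Module.finrank ℂ (defectSpace φ S z) =
      Module.finrank ℂ K := by
  rw [hφ.finrank_eq_dualAnnihilator fun g => mem_defectSpace]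
  exact Subspace.finrank_add_finrank_dualAnnihilator_eq _

theorem IsResolventAt.mem {z : ℂ} {R : K →ₗ[ℂ] K} (hR : IsResolventAt A z R) (h : K) :
    (R h, h + z • R h) ∈ A := by
  rw [hR]; simp

theorem IsResolventAt.apply {z : ℂ} {R : K →ₗ[ℂ] K} (hR : IsResolventAt A z R) {f g : K}
    (h : (f, g) ∈ A) : R (g - z • f) = f := (hR f g).1 h

/-- The resolvent identity, in the form `(A - w)⁻¹ (I + (z - w) (A - z)⁻¹) = (A - z)⁻¹`. -/
theorem IsResolventAt.resolvent_identity {z w : ℂ} {R R' : K →ₗ[ℂ] K} (hR : IsResolventAt A z R)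
    (hR' : IsResolventAt A w R') (f : K) : R' (f + (z - w) • R f) = R f := by
  have := hR'.apply (hR.mem f)
  rwa [add_sub_assoc, ← sub_smul] at this

/-- For self-adjoint `A`, the adjoint of `(A - z)⁻¹` is `(A - z^*)⁻¹`; in particular `ρ(A)` is
symmetric with respect to the real axis. -/
theorem IsResolventAt.conj [FiniteDimensional ℂ K] (hφ : IsPontryaginForm φ)
    (hA : IsSelfAdjointRel φ A) {z : ℂ} {R : K →ₗ[ℂ] K} (hR : IsResolventAt A z R) :
    ∃ R' : K →ₗ[ℂ] K, IsResolventAt A (conj z) R' ∧ ∀ f g, φ f (R' g) = φ (R f) g := by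
  obtain ⟨R', hR'⟩ := hφ.exists_adjoint R
  refine ⟨R', fun f g => ⟨fun hfg => ?_, fun hfg => ?_⟩, hR'⟩
  · refine hφ.eq_of_forall_right fun h => ?_
    rw [hR']
    have hmem : (f, g) ∈ adjointRel φ A := hA.symm ▸ hfg
    have := hmem _ (hR.mem h)
    simp only [map_add, map_smul, LinearMap.add_apply, LinearMap.smul_apply] at this
    simp [← this]
  · have : (f, g) ∈ adjointRel φ A := by
      rintro ⟨p, q⟩ hpq
      have h1 := hR' (q - z • p) (g - (starRingEnd ℂ) z • f)
      rw [hfg, hR.apply hpq] at h1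
      simpa using h1
    rwa [hA] at this

/-- The resolvent set of a linear relation in a finite dimensional space is empty or has a finite
complement: a point `w ∉ ρ(A)` gives the eigenvalue `(w - z)⁻¹` of `(A - z)⁻¹`. -/
theorem IsResolventAt.finite_compl [FiniteDimensional ℂ K] {z : ℂ} {R : K →ₗ[ℂ] K}
    (hR : IsResolventAt A z R) : (resolventSet A)ᶜ.Finite := by
  have hfin : (spectrum ℂ R).Finite := Module.End.finite_spectrum R
  refine (hfin.image fun c => z + c⁻¹).subset fun w hw => ?_
  have hwz : w - z ≠ 0 := by
    intro h
    rw [sub_eq_zero] at h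
    exact hw ⟨R, h ▸ hR⟩
  refine ⟨(w - z)⁻¹, ?_, by simp⟩
  rw [← Module.End.hasEigenvalue_iff_mem_spectrum]
  by_contra hno
  refine hw ?_
  let T : K →ₗ[ℂ] K := LinearMap.id - (w - z) • R
  have hT : Function.Injective T := by
    rw [injective_iff_map_eq_zero]
    intro h hh
    by_contra h0
    refine hno (Module.End.hasEigenvalue_of_hasEigenvector (x := h) ⟨?_, h0⟩)
    rw [Module.End.mem_eigenspace_iff]
    have : h = (w - z) • R h := sub_eq_zero.1 hh
    rw [eq_inv_smul_iff₀ hwz]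
    exact this.symm
  let e := LinearEquiv.ofInjectiveEndo T hT
  have he : ∀ h, e h = h - (w - z) • R h := fun h => rfl
  refine ⟨R ∘ₗ e.symm, fun f g => ⟨fun hfg => ?_, fun hfg => ?_⟩⟩
  · have h1 := hR.apply hfg
    have : e (g - z • f) = g - w • f := by
      rw [he, h1]; module
    rw [← this]
    simp [h1]
  · rw [LinearMap.comp_apply, LinearEquiv.coe_coe] at hfg
    rw [hR]
    have h1 := he (e.symm (g - w • f))
    rw [e.apply_symm_apply, hfg] at h1
    rw [← hfg]
    congr 1
    rw [hfg, ← sub_eq_zero]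
    have h2 : e.symm (g - w • f) = g - w • f + (w - z) • f :=
      eq_add_of_sub_eq h1.symm
    rw [h2]; module

end Relations

/-! ### Evaluation of vector and matrix polynomials -/

section Evaluation

variable {d : ℕ}

theorem evalVec_apply (z : ℂ) (f : Fin d → ℂ[X]) (i : Fin d) : evalVec z f i = (f i).eval z := rfl

theorem evalVec_X_smul (z : ℂ) (f : Fin d → ℂ[X]) :
    evalVec z ((X : ℂ[X]) • f) = z • evalVec z f := by
  ext i
  simp [evalVec_apply]

theorem evalMat_apply (M : Matrix (Fin d) (Fin d) ℂ[X]) (z : ℂ) (i j : Fin d) :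
    evalMat M z i j = (M i j).eval z := rfl

theorem eval_det (M : Matrix (Fin d) (Fin d) ℂ[X]) (z : ℂ) :
    M.det.eval z = (evalMat M z).det :=
  RingHom.map_det (Polynomial.evalRingHom z) M

theorem continuous_evalMat (M : Matrix (Fin d) (Fin d) ℂ[X]) : Continuous (evalMat M) :=
  continuous_matrix fun i j => (M i j).continuous

theorem eq_zero_of_evalVec_eq_zero {f : Fin d → ℂ[X]} {s : Set ℂ} (hs : s.Infinite)
    (h : ∀ z ∈ s, evalVec z f = 0) : f = 0 := by
  ext1 i
  exact Polynomial.eq_zero_of_infinite_isRoot _ (hs.mono fun z hz => congrFun (h z hz) i)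

end Evaluation

/-! ### Multiplication by the independent variable and its defect numbers -/

section MulRel

variable {d : ℕ} {B : Submodule ℂ (Fin d → ℂ[X])}

theorem mem_mulRel {f g : B} :
    (f, g) ∈ mulRel B ↔ (g : Fin d → ℂ[X]) = (X : ℂ[X]) • (f : Fin d → ℂ[X]) := Iff.rfl

theorem ranSub_mulRel_le (z : ℂ) :
    ranSub (mulRel B) z ≤ LinearMap.ker (evalVec z ∘ₗ B.subtype) := by
  intro h hh
  obtain ⟨f, g, hfg, rfl⟩ := mem_ranSub.1 hh
  rw [mem_mulRel] at hfg
  simp [hfg, evalVec_X_smul]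

/-- `S_𝔅 - z` is injective, so the dimension of its range does not depend on `z`. -/
theorem finrank_ranSub_mulRel (z : ℂ) :
    Module.finrank ℂ (ranSub (mulRel B) z) = Module.finrank ℂ (mulRel B) := by
  let D : B × B →ₗ[ℂ] B := LinearMap.snd ℂ B B - z • LinearMap.fst ℂ B B
  have hinj : Function.Injective (D ∘ₗ (mulRel B).subtype) := by
    rw [injective_iff_map_eq_zero]
    rintro ⟨⟨f, g⟩, hfg⟩ h0
    have h1 : (g : Fin d → ℂ[X]) - z • (f : Fin d → ℂ[X]) = 0 := congrArg Subtype.val h0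
    rw [mem_mulRel] at hfg
    have hf : (f : Fin d → ℂ[X]) = 0 := by
      ext1 i
      have h2 := congrFun h1 i
      rw [hfg] at h2
      have h3 : (X - C z) * (f : Fin d → ℂ[X]) i = 0 := by
        rw [sub_mul, ← Polynomial.smul_eq_C_mul]
        exact h2
      exact (mul_eq_zero.1 h3).resolve_left (Polynomial.X_sub_C_ne_zero z)
    have hg : (g : Fin d → ℂ[X]) = 0 := by rw [hfg, hf, smul_zero]
    exact Subtype.ext (Prod.ext (Subtype.ext hf) (Subtype.ext hg))
  have : ranSub (mulRel B) z = LinearMap.range (D ∘ₗ (mulRel B).subtype) := by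
    rw [LinearMap.range_comp, Submodule.range_subtype]
    rfl
  rw [this, LinearMap.finrank_range_of_inj hinj]

variable [FiniteDimensional ℂ B] {φ : B →ₗ[ℂ] B →ₗ⋆[ℂ] ℂ} {α : ℂ}

theorem hasDefectNumbers_mulRel (hφ : IsPontryaginForm φ)
    (hα : ranSub (mulRel B) α = LinearMap.ker (evalVec α ∘ₗ B.subtype)) :
    HasDefectNumbers φ (mulRel B)
      (Module.finrank ℂ (LinearMap.range (evalVec α ∘ₗ B.subtype))) := by
  intro z _
  have h1 := finrank_defectSpace_add (S := mulRel B) hφ z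
  have h2 := LinearMap.finrank_range_add_finrank_ker (evalVec α ∘ₗ B.subtype)
  rw [← hα, finrank_ranSub_mulRel] at h2
  rw [finrank_ranSub_mulRel] at h1
  omega

/-- If `E_α` vanished on `𝔅`, then `S_𝔅 - α` would be onto, hence so would be `S_𝔅 - z` for every
`z`, and all elements of `𝔅` would vanish everywhere. -/
theorem one_le_finrank_range_evalVec
    (hα : ranSub (mulRel B) α = LinearMap.ker (evalVec α ∘ₗ B.subtype)) (hB : B ≠ ⊥) :
    1 ≤ Module.finrank ℂ (LinearMap.range (evalVec α ∘ₗ B.subtype)) := by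
  by_contra! hlt
  have h2 := LinearMap.finrank_range_add_finrank_ker (evalVec α ∘ₗ B.subtype)
  rw [← hα, finrank_ranSub_mulRel] at h2
  refine hB ((Submodule.eq_bot_iff B).2 fun f hf => ?_)
  refine eq_zero_of_evalVec_eq_zero Set.infinite_univ fun z _ => ?_
  have htop : ranSub (mulRel B) z = ⊤ := by
    apply Submodule.eq_top_of_finrank_eq
    rw [finrank_ranSub_mulRel]
    omega
  have hmem : (⟨f, hf⟩ : B) ∈ ranSub (mulRel B) z := htop ▸ Submodule.mem_top
  exact LinearMap.mem_ker.1 (ranSub_mulRel_le z hmem)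

end MulRel

/-! ### Symmetry of `Q`-functions and of their kernels -/

section QFunction

variable {K : Type*} [AddCommGroup K] [Module ℂ K] {φ : K →ₗ[ℂ] K →ₗ⋆[ℂ] ℂ} {l : ℕ}

/-- The adjoint `T^* : K → ℂ^l` of `T : ℂ^l → K`, with respect to the standard inner product of
`ℂ^l`. -/
noncomputable def adjVec (φ : K →ₗ[ℂ] K →ₗ⋆[ℂ] ℂ) (T : (Fin l → ℂ) →ₗ[ℂ] K) :
    K →ₗ[ℂ] (Fin l → ℂ) :=
  LinearMap.pi fun i => φ.flip (T (Pi.single i 1))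

theorem adjVec_apply (T : (Fin l → ℂ) →ₗ[ℂ] K) (f : K) (i : Fin l) :
    adjVec φ T f i = φ f (T (Pi.single i 1)) := rfl

theorem map_eq_sum_single (T : (Fin l → ℂ) →ₗ[ℂ] K) (x : Fin l → ℂ) :
    T x = ∑ i, x i • T (Pi.single i 1) := by
  conv_lhs => rw [pi_eq_sum_univ' x]
  simp

theorem form_map (T : (Fin l → ℂ) →ₗ[ℂ] K) (f : K) (x : Fin l → ℂ) :
    φ f (T x) = star x ⬝ᵥ adjVec φ T f := by
  rw [map_eq_sum_single T x]
  simp [dotProduct, adjVec_apply]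

theorem defectKernel_mulVec (Γ : ℂ → (Fin l → ℂ) →ₗ[ℂ] K) (z w : ℂ) (x : Fin l → ℂ) :
    defectKernel φ Γ z w *ᵥ x = adjVec φ (Γ w) (Γ z x) := by
  ext i
  rw [adjVec_apply, map_eq_sum_single (Γ z) x]
  simp [Matrix.mulVec, dotProduct, defectKernel, mul_comm]

/-- If `T` is injective, then `T^*` is onto; more precisely, it maps suitable vectors to the standard
basis. -/
theorem exists_adjVec_eq_single [FiniteDimensional ℂ K] (hφ : IsPontryaginForm φ)
    {T : (Fin l → ℂ) →ₗ[ℂ] K} (hT : Function.Injective T) (j : Fin l) :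
    ∃ g : K, adjVec φ T g = Pi.single j 1 := by
  obtain ⟨L, hL⟩ := T.exists_leftInverse_of_injective (LinearMap.ker_eq_bot.2 hT)
  refine ⟨hφ.riesz.symm (LinearMap.proj j ∘ₗ L), ?_⟩
  ext i
  rw [adjVec_apply, ← hφ.hermitian, hφ.apply_riesz_symm]
  have : L (T (Pi.single i 1)) = Pi.single i 1 := LinearMap.congr_fun hL _
  simp [this, Pi.single_apply, eq_comm]

variable {S A : Submodule ℂ (K × K)} {Γ : ℂ → (Fin l → ℂ) →ₗ[ℂ] K}
  {Q : ℂ → Matrix (Fin l) (Fin l) ℂ}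

theorem IsQFunction.finite_compl [FiniteDimensional ℂ K] (hQ : IsQFunction φ S A Γ Q) :
    (resolventSet A)ᶜ.Finite := by
  obtain ⟨μ, ⟨R, hR⟩, -⟩ := hQ.defect_maps
  exact hR.finite_compl

theorem IsQFunction.conj_mem [FiniteDimensional ℂ K] (hφ : IsPontryaginForm φ)
    (hQ : IsQFunction φ S A Γ Q) {z : ℂ} (hz : z ∈ resolventSet A) :
    conj z ∈ resolventSet A := by
  obtain ⟨R, hR⟩ := hz
  obtain ⟨R', hR', -⟩ := hR.conj hφ hQ.selfAdjoint
  exact ⟨R', hR'⟩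

/-- The reflection principle `Q(z^*) = Q(z)^*`. -/
theorem IsQFunction.apply_conj [FiniteDimensional ℂ K] (hφ : IsPontryaginForm φ)
    (hQ : IsQFunction φ S A Γ Q) {z : ℂ} (hz : z ∈ resolventSet A) : Q (conj z) = (Q z)ᴴ := by
  have := hQ.kernel_eq _ (hQ.conj_mem hφ hz) _ hz
  rwa [sub_self, zero_smul, sub_eq_zero] at this

/-- `Γ_w^* Γ_z = Γ_{z^*}^* Γ_{w^*}`, a consequence of the reflection principle. -/
theorem IsQFunction.defectKernel_conj [FiniteDimensional ℂ K] (hφ : IsPontryaginForm φ)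
    (hQ : IsQFunction φ S A Γ Q) {z w : ℂ} (hz : z ∈ resolventSet A) (hw : w ∈ resolventSet A) :
    defectKernel φ Γ (conj w) (conj z) = defectKernel φ Γ z w := by
  by_cases h : z = conj w
  · simp [h]
  · have h1 := hQ.kernel_eq z hz w hw
    have h2 := hQ.kernel_eq _ (hQ.conj_mem hφ hw) _ (hQ.conj_mem hφ hz)
    rw [hQ.apply_conj hφ hz, hQ.apply_conj hφ hw, Matrix.conjTranspose_conjTranspose,
      Complex.conj_conj, ← neg_sub, h1, ← neg_smul, neg_sub] at h2
    have h3 : conj w - z ≠ 0 := fun h' => h (sub_eq_zero.1 h').symm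
    exact (smul_right_injective _ h3 h2).symm

end QFunction

/-! ### The polynomial columns of `M` and `N` -/

section Columns

variable {d l : ℕ} {B : Submodule ℂ (Fin d → ℂ[X])} [FiniteDimensional ℂ B]
  {φ : B →ₗ[ℂ] B →ₗ⋆[ℂ] ℂ} {A : Submodule ℂ (B × B)} {Γ : ℂ → (Fin l → ℂ) →ₗ[ℂ] B}
  {Q : ℂ → Matrix (Fin l) (Fin l) ℂ}

/-- The core of the argument: the polynomial columns `n j`, `m j` of `N` and `M`. With
`R = (A - μ^*)⁻¹` and `g j ∈ 𝔅` such that `Γ_μ^* (g j)` is the `j`-th unit vector, they are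
`n j = g j - (X - μ^*) R (g j)` and `m j = ∑ i, (Q(μ)^*)_{ij} n i + (X - μ^*) Γ_{μ^*} e_j`. -/
theorem IsQFunction.exists_columns (hφ : IsPontryaginForm φ)
    (hQ : IsQFunction φ (mulRel B) A Γ Q) :
    ∃ n m : Fin l → Fin d → ℂ[X],
      (∀ z ∈ resolventSet A, ∀ f : B,
        evalVec z (f : Fin d → ℂ[X]) = ∑ j, adjVec φ (Γ (conj z)) f j • evalVec z (n j)) ∧
      ∀ z ∈ resolventSet A, ∀ j, evalVec z (m j) = ∑ i, Q z i j • evalVec z (n i) := by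
  obtain ⟨μ, hμ, -, hinj, hran, hΓ⟩ := hQ.defect_maps
  obtain ⟨Rμ, hRμ⟩ := id hμ
  obtain ⟨R, hR, -⟩ := hRμ.conj hφ hQ.selfAdjoint
  choose g hg using fun j => exists_adjVec_eq_single hφ hinj j
  let D : B →ₗ[ℂ] (Fin d → ℂ[X]) :=
    B.subtype - (LinearMap.lsmul ℂ[X] (Fin d → ℂ[X]) (X - C (conj μ))).restrictScalars ℂ ∘ₗ
      B.subtype ∘ₗ R
  have hDeval : ∀ z f, evalVec z (D f) =
      evalVec z ((f : Fin d → ℂ[X]) - (z - conj μ) • (R f : Fin d → ℂ[X])) := by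
    intro z f
    ext i
    simp [D, evalVec_apply]
    ring
  -- `D` vanishes on `ran (S_𝔅 - μ^*)`, which is the kernel of `Γ_μ^*`
  have hDker : ∀ h, adjVec φ (Γ μ) h = 0 → D h = 0 := by
    intro h hh
    have hmem : h ∈ ranSub (mulRel B) (conj μ) := by
      refine hφ.mem_of_orthogonal fun k hk => ?_
      have hk' : k ∈ LinearMap.range (Γ μ) := by rwa [hran, mem_defectSpace]
      obtain ⟨x, rfl⟩ := hk'
      rw [form_map, hh, dotProduct_zero]
    obtain ⟨p, q, hpq, rfl⟩ := mem_ranSub.1 hmem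
    have hRp := hR.apply (hQ.extends_rel hpq)
    rw [mem_mulRel] at hpq
    ext1 i
    simp [D, hRp, hpq, Polynomial.smul_eq_C_mul]
  have hD : ∀ f, D f = ∑ j, adjVec φ (Γ μ) f j • D (g j) := by
    intro f
    have : D (f - ∑ j, adjVec φ (Γ μ) f j • g j) = 0 := by
      refine hDker _ ?_
      ext i
      simp [hg, Pi.single_apply]
    simpa only [map_sub, map_sum, map_smul, sub_eq_zero] using this
  refine ⟨fun j => D (g j), fun j => (∑ i, (Q μ)ᴴ i j • D (g i)) +
    (X - C (conj μ)) • (Γ (conj μ) (Pi.single j 1) : Fin d → ℂ[X]), ?_, ?_⟩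
  · rintro z ⟨Rz, hRz⟩ f
    obtain ⟨Rz', hRz', hadj⟩ := hRz.conj hφ hQ.selfAdjoint
    have h1 : adjVec φ (Γ (conj z)) f = adjVec φ (Γ μ) (f + (z - conj μ) • Rz f) := by
      ext j
      simp only [adjVec_apply]
      rw [hΓ (conj z) Rz' hRz']
      simp [hadj]
    rw [h1]
    have h2 := congrArg (evalVec z) (hD (f + (z - conj μ) • Rz f))
    rw [hDeval, hRz.resolvent_identity hR] at h2
    simpa using h2
  · rintro z ⟨Rz, hRz⟩ j
    set v := Γ μ (Pi.single j 1) with hv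
    have hz : Γ z (Pi.single j 1) = v + (z - μ) • Rz v := by
      rw [hΓ z Rz hRz]; simp [v]
    have hc : Γ (conj μ) (Pi.single j 1) = v + (conj μ - μ) • R v := by
      rw [hΓ _ R hR]; simp [v]
    -- the resolvent identity gives `(I - (z - μ^*) R) Γ_z = Γ_{μ^*}`
    have hres : Γ z (Pi.single j 1) - (z - conj μ) • R (Γ z (Pi.single j 1)) =
        Γ (conj μ) (Pi.single j 1) := by
      have h1 := hRz.resolvent_identity hR v
      rw [map_add, map_smul] at h1
      rw [hz, hc, map_add, map_smul, smul_add, smul_comm (z - conj μ) (z - μ),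
        eq_sub_of_add_eq' h1]
      module
    have hQz : ∀ i, Q z i j =
        (Q μ)ᴴ i j + (z - conj μ) * adjVec φ (Γ μ) (Γ z (Pi.single j 1)) i := by
      intro i
      have := congrFun (congrFun (hQ.kernel_eq z ⟨Rz, hRz⟩ μ hμ) i) j
      rw [Matrix.sub_apply, sub_eq_iff_eq_add'] at this
      exact this
    have h3 := congrArg (evalVec z) (hD (Γ z (Pi.single j 1)))
    rw [hDeval, ← Submodule.coe_smul, ← Submodule.coe_sub, hres, map_sum] at h3
    have h4 : evalVec z ((X - C (conj μ)) • (Γ (conj μ) (Pi.single j 1) : Fin d → ℂ[X])) =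
        (z - conj μ) • evalVec z (Γ (conj μ) (Pi.single j 1) : Fin d → ℂ[X]) := by
      ext i
      simp [evalVec_apply]
    simp only [map_add, h4, h3, hQz, add_smul, Finset.sum_add_distrib, mul_smul, map_sum, map_smul,
      Finset.smul_sum]

end Columns

/-! ### Completion to a regular matrix polynomial -/

section Completion

variable {d l : ℕ}

/-- A basis of `ℂ^d` whose first `l` vectors lie in a given `l`-dimensional subspace. -/
theorem exists_basis_castLE_mem {V : Submodule ℂ (Fin d → ℂ)} (hV : Module.finrank ℂ V = l)
    (hl : l ≤ d) : ∃ b : Module.Basis (Fin d) ℂ (Fin d → ℂ), ∀ j : Fin l, b (Fin.castLE hl j) ∈ V := by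
  obtain ⟨W, hW⟩ := V.exists_isCompl
  have hWd : Module.finrank ℂ W = d - l := by
    have := Submodule.finrank_add_eq_of_isCompl hW
    rw [Module.finrank_fin_fun, hV] at this
    omega
  let b := (((Module.finBasisOfFinrankEq ℂ V hV).prod (Module.finBasisOfFinrankEq ℂ W hWd)).map
    (Submodule.prodEquivOfIsCompl V W hW)).reindex
      (finSumFinEquiv.trans (finCongr (Nat.add_sub_of_le hl)))
  refine ⟨b, fun j => ?_⟩
  have : (finSumFinEquiv.trans (finCongr (Nat.add_sub_of_le hl))).symm (Fin.castLE hl j) =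
      Sum.inl j := by
    rw [Equiv.symm_apply_eq]
    ext
    simp
  simp only [b, Module.Basis.reindex_apply, this]
  simp

/-- Columns `n j` which generate the values of `𝔅` can be completed by constant columns to a matrix
polynomial with nonvanishing determinant. -/
theorem exists_completion {B : Submodule ℂ (Fin d → ℂ[X])} {α : ℂ}
    (hl : Module.finrank ℂ (LinearMap.range (evalVec α ∘ₗ B.subtype)) = l) (hld : l ≤ d)
    {s : Set ℂ} (hs : sᶜ.Finite) {n : Fin l → Fin d → ℂ[X]}
    (hn : ∀ z ∈ s, ∀ f ∈ B, ∃ c : Fin l → ℂ, evalVec z f = ∑ j, c j • evalVec z (n j)) :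
    ∃ N : Matrix (Fin d) (Fin d) ℂ[X], N.det ≠ 0 ∧ ∀ i j, N i (Fin.castLE hld j) = n j i := by
  obtain ⟨b, hb⟩ := exists_basis_castLE_mem hl hld
  choose f hf using hb
  -- completion of arbitrary columns `p` by elements of the basis `b`
  let comp : (Fin l → Fin d → ℂ[X]) → Matrix (Fin d) (Fin d) ℂ[X] := fun p =>
    Matrix.of fun i k => if h : (k : ℕ) < l then p ⟨k, h⟩ i else C (b k i)
  have hcomp : ∀ p i j, comp p i (Fin.castLE hld j) = p j i := by
    intro p i j
    simp [comp]
  have hdet : ∀ M : Matrix (Fin d) (Fin d) ℂ, (∀ v : Fin d → ℂ, (∀ k, v ⬝ᵥ (fun i => M i k) = 0) →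
      v = 0) → M.det ≠ 0 := by
    intro M hM h0
    obtain ⟨v, hv, hv0⟩ := Matrix.exists_vecMul_eq_zero_iff.2 h0
    exact hv (hM v fun k => congrFun hv0 k)
  have hlt : ∀ k : Fin d, (k : ℕ) < l → ∃ j : Fin l, Fin.castLE hld j = k :=
    fun k hk => ⟨⟨k, hk⟩, rfl⟩
  have hcol : ∀ p z (j : Fin l), (fun i => evalMat (comp p) z i (Fin.castLE hld j)) =
      evalVec z (p j) := fun p z j => funext fun i => by rw [evalMat_apply, hcomp]; rfl
  have hcol' : ∀ p z (k : Fin d), ¬ (k : ℕ) < l → (fun i => evalMat (comp p) z i k) = b k :=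
    fun p z k hk => funext fun i => by simp [evalMat_apply, comp, hk]
  let q : Fin l → Fin d → ℂ[X] := fun j => f j
  have hF : (comp q).det ≠ 0 := by
    intro h0
    refine hdet (evalMat (comp q) α) (fun v hv => ?_) (by rw [← eval_det, h0, eval_zero])
    have hvb : ∀ k, v ⬝ᵥ b k = 0 := by
      intro k
      by_cases hk : (k : ℕ) < l
      · obtain ⟨j, rfl⟩ := hlt k hk
        have := hv (Fin.castLE hld j)
        rw [hcol] at this
        rw [← hf j]
        exact this
      · have := hv k
        rwa [hcol' _ _ _ hk] at this
    have hv0 : dotProductBilin ℂ ℂ v = 0 := b.ext hvb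
    exact dotProduct_eq_zero v fun w => LinearMap.congr_fun hv0 w
  have hroots : {z | (comp q).det.eval z = 0}.Finite := by
    refine (Multiset.finite_toSet (comp q).det.roots).subset fun z hz => ?_
    exact (Polynomial.mem_roots hF).2 hz
  obtain ⟨z, hz⟩ := (hs.union hroots).infinite_compl.nonempty
  rw [Set.mem_compl_iff, Set.mem_union, not_or, Set.mem_compl_iff, not_not] at hz
  refine ⟨comp n, fun h0 => ?_, hcomp n⟩
  refine hdet (evalMat (comp n) z) (fun v hv => ?_) (by rw [← eval_det, h0, eval_zero])
  by_contra hv0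
  refine hz.2 ?_
  rw [Set.mem_ofPred_eq, eval_det]
  refine Matrix.exists_vecMul_eq_zero_iff.1 ⟨v, hv0, ?_⟩
  ext k
  suffices v ⬝ᵥ (fun i => evalMat (comp q) z i k) = 0 from this
  by_cases hk : (k : ℕ) < l
  · obtain ⟨j, rfl⟩ := hlt k hk
    obtain ⟨c, hc⟩ := hn z hz.1 (f j) (f j).2
    rw [hcol, hc, dotProduct_sum]
    refine Finset.sum_eq_zero fun i _ => ?_
    have := hv (Fin.castLE hld i)
    rw [hcol] at this
    rw [dotProduct_smul, this, smul_zero]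
  · have := hv k
    rw [hcol' _ _ _ hk] at this
    rwa [hcol' _ _ _ hk]

end Completion

/-! ### The reproducing kernel and its negative squares -/

section Kernel

variable {d : ℕ} {B : Submodule ℂ (Fin d → ℂ[X])} [FiniteDimensional ℂ B]
  {φ : B →ₗ[ℂ] B →ₗ⋆[ℂ] ℂ}

/-- The vector `E_w^* x`, where `E_w^* : ℂ^d → 𝔅` is the adjoint of the evaluation at `w`; as a
function it is `K(·, w) x`, with `K` the reproducing kernel. -/
noncomputable def evalAdj (hφ : IsPontryaginForm φ) (w : ℂ) (x : Fin d → ℂ) : B :=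
  hφ.riesz.symm (dotProductBilin ℂ ℂ (star x) ∘ₗ evalVec w ∘ₗ B.subtype)

theorem form_evalAdj (hφ : IsPontryaginForm φ) (w : ℂ) (x : Fin d → ℂ) (f : B) :
    φ f (evalAdj hφ w x) = star x ⬝ᵥ evalVec w (f : Fin d → ℂ[X]) :=
  hφ.apply_riesz_symm _ f

theorem evalAdj_eq_sum (hφ : IsPontryaginForm φ) (w : ℂ) (x : Fin d → ℂ) :
    evalAdj hφ w x = ∑ j, x j • evalAdj hφ w (Pi.single j 1) := by
  refine hφ.eq_of_forall_right fun f => ?_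
  simp only [map_sum, LinearMap.map_smulₛₗ, form_evalAdj, smul_eq_mul]
  simp [dotProduct, Pi.single_apply]

/-- The reproducing kernel `K(z, w) = E_z E_w^*` of `𝔅`. -/
noncomputable def reproKernel (hφ : IsPontryaginForm φ) (z w : ℂ) : Matrix (Fin d) (Fin d) ℂ :=
  Matrix.of fun i j => evalVec z (evalAdj hφ w (Pi.single j 1) : Fin d → ℂ[X]) i

theorem reproKernel_mulVec (hφ : IsPontryaginForm φ) (z w : ℂ) (x : Fin d → ℂ) :
    reproKernel hφ z w *ᵥ x = evalVec z (evalAdj hφ w x : Fin d → ℂ[X]) := by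
  rw [evalAdj_eq_sum]
  ext i
  simp [Matrix.mulVec, dotProduct, reproKernel, mul_comm]

theorem isReproducingKernel_reproKernel (hφ : IsPontryaginForm φ) :
    IsReproducingKernel φ (fun z : ℂ => evalVec z ∘ₗ B.subtype) (reproKernel hφ) :=
  fun w x => ⟨evalAdj hφ w x, fun z => (reproKernel_mulVec hφ z w x).symm, form_evalAdj hφ w x⟩

theorem reproKernel_conjTranspose (hφ : IsPontryaginForm φ) (z w : ℂ) :
    (reproKernel hφ z w)ᴴ = reproKernel hφ w z := by
  have h : ∀ z w i j, reproKernel hφ z w i j =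
      φ (evalAdj hφ w (Pi.single j 1)) (evalAdj hφ z (Pi.single i 1)) := by
    intro z w i j
    rw [form_evalAdj]
    simp [reproKernel, dotProduct, Pi.single_apply]
  ext i j
  rw [Matrix.conjTranspose_apply, h, h]
  exact hφ.hermitian _ _

theorem continuous_reproKernel (hφ : IsPontryaginForm φ) (w : ℂ) :
    Continuous fun z => reproKernel hφ z w :=
  continuous_matrix fun i j =>
    ((evalAdj hφ w (Pi.single j 1) : Fin d → ℂ[X]) i).continuous

/-- An identity of matrix polynomials in `z` and `w^*` that holds on a dense set holds
everywhere. -/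
theorem kernel_identity_of_dense (hφ : IsPontryaginForm φ) {M N : Matrix (Fin d) (Fin d) ℂ[X]}
    {s : Set ℂ} (hs : Dense s)
    (h : ∀ z ∈ s, ∀ w ∈ s, evalMat M z * (evalMat N w)ᴴ - evalMat N z * (evalMat M w)ᴴ =
      (z - conj w) • reproKernel hφ z w) (z w : ℂ) :
    evalMat M z * (evalMat N w)ᴴ - evalMat N z * (evalMat M w)ᴴ =
      (z - conj w) • reproKernel hφ z w := by
  have hext : ∀ w, (∀ z ∈ s, evalMat M z * (evalMat N w)ᴴ - evalMat N z * (evalMat M w)ᴴ =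
      (z - conj w) • reproKernel hφ z w) → ∀ z,
      evalMat M z * (evalMat N w)ᴴ - evalMat N z * (evalMat M w)ᴴ =
        (z - conj w) • reproKernel hφ z w := by
    intro w hw
    refine fun z => congrFun (Continuous.ext_on hs ?_ ?_ hw) z
    · exact ((continuous_evalMat M).matrix_mul continuous_const).sub
        ((continuous_evalMat N).matrix_mul continuous_const)
    · exact (continuous_id.sub continuous_const).smul (continuous_reproKernel hφ w)
  refine hext w (fun z hz => ?_) z
  -- both sides are skew-symmetric, which exchanges the roles of `z` and `w`
  have h1 := congrArg Matrix.conjTranspose (hext z (fun w hw => h w hw z hz) w)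
  rw [Matrix.conjTranspose_sub, Matrix.conjTranspose_mul, Matrix.conjTranspose_mul,
    Matrix.conjTranspose_smul, Matrix.conjTranspose_conjTranspose,
    Matrix.conjTranspose_conjTranspose, reproKernel_conjTranspose] at h1
  have h2 : star (w - conj z) = -(z - conj w) := by simp
  rw [h2, neg_smul] at h1
  rw [← neg_sub, h1, neg_neg]

theorem span_evalAdj (hφ : IsPontryaginForm φ) :
    Submodule.span ℂ {g | ∃ (z : ℂ) (x : Fin d → ℂ), 0 < z.im ∧ evalAdj hφ z x = g} = ⊤ := by
  refine eq_top_iff.2 fun h _ => hφ.mem_of_orthogonal fun g hg => ?_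
  have hg0 : g = 0 := by
    refine Subtype.ext (eq_zero_of_evalVec_eq_zero (s := {z : ℂ | 0 < z.im}) ?_ fun z hz => ?_)
    · refine Set.infinite_of_injective_forall_mem (f := fun n : ℕ => ((n : ℂ) + Complex.I))
        (fun a b hab => ?_) (fun n => ?_)
      · simpa using hab
      · simp
    · ext i
      have := hg _ (Submodule.subset_span ⟨z, Pi.single i 1, hz, rfl⟩)
      rw [← hφ.hermitian, form_evalAdj, map_eq_zero] at this
      simpa [dotProduct, Pi.single_apply] using this
  rw [hg0, map_zero]

/-- If `K_{M,N}` is the reproducing kernel of `𝔅`, its matrices are Gram matrices of vectors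
`E_z^* x`, which already span `𝔅` for `z` in the upper half plane. -/
theorem hasNegativeSquares_of_reproKernel (hφ : IsPontryaginForm φ)
    {M N : Matrix (Fin d) (Fin d) ℂ[X]}
    (h : ∀ z w : ℂ, z ≠ conj w → reproKernel hφ z w = nevanlinnaKernel M N z w)
    {κ : ℕ} (hκ : HasNegativeIndex φ κ) : HasNegativeSquares M N κ := by
  have hgram : ∀ {n : ℕ} (z : Fin n → ℂ) (x : Fin n → Fin d → ℂ), (∀ i j, z i ≠ conj (z j)) →
      ∀ i j, kernelGram M N z x i j = φ (evalAdj hφ (z i) (x i)) (evalAdj hφ (z j) (x j)) := by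
    intro n z x hz i j
    rw [form_evalAdj, ← reproKernel_mulVec, h _ _ (hz j i)]
    rfl
  have hle : ∀ {n : ℕ} (z : Fin n → ℂ) (x : Fin n → Fin d → ℂ), (∀ i j, z i ≠ conj (z j)) →
      Nat.card {i : Fin n // (kernelGram_isHermitian M N z x).eigenvalues i < 0} ≤ κ :=
    fun z x hz => hκ.card_neg_eigenvalues_le _ (hgram z x hz)
  refine ⟨?_, ?_⟩
  · obtain ⟨v, hv, hspan, -⟩ := Submodule.exists_fun_fin_finrank_span_eq ℂ
      {g | ∃ (z : ℂ) (x : Fin d → ℂ), 0 < z.im ∧ evalAdj hφ z x = g}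
    choose z x hz hzx using hv
    have hne : ∀ i j, z i ≠ conj (z j) := by
      intro i j hij
      have := congrArg Complex.im hij
      rw [Complex.conj_im] at this
      linarith [hz i, hz j]
    refine ⟨_, z, x, hne, (hle z x hne).antisymm ?_⟩
    refine hκ.le_card_neg_eigenvalues _ (hgram z x hne) ?_
    simp only [hzx]
    rw [hspan, span_evalAdj]
  · rintro m ⟨n, z, x, hz, rfl⟩
    exact hle z x hz

end Kernel

/-! ### Padding by zeros -/

section Padding

variable {d l : ℕ}

/-- The matrix of the embedding of `ℂ^l` as the first `l` coordinates of `ℂ^d`. -/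
def inclMat (hld : l ≤ d) : Matrix (Fin d) (Fin l) ℂ :=
  Matrix.of fun i j => if i = Fin.castLE hld j then 1 else 0

theorem mul_inclMat_apply (hld : l ≤ d) (Y : Matrix (Fin d) (Fin d) ℂ) (i : Fin d) (j : Fin l) :
    (Y * inclMat hld) i j = Y i (Fin.castLE hld j) := by
  simp [Matrix.mul_apply, inclMat]

theorem eq_castLE_iff (hld : l ≤ d) (i : Fin d) (j : Fin l) (h : (i : ℕ) < l) :
    i = Fin.castLE hld j ↔ ⟨i, h⟩ = j := by
  simp [Fin.ext_iff]

theorem inclMat_mul_apply (hld : l ≤ d) {m : Type*} (Y : Matrix (Fin l) m ℂ) (i : Fin d) (j : m) :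
    (inclMat hld * Y) i j = if h : (i : ℕ) < l then Y ⟨i, h⟩ j else 0 := by
  rw [Matrix.mul_apply]
  split_ifs with h
  · simp [inclMat, eq_castLE_iff hld _ _ h]
  · refine Finset.sum_eq_zero fun k _ => ?_
    have : i ≠ Fin.castLE hld k := fun hk => h (hk ▸ k.2)
    simp [inclMat, this]

theorem padMat_eq (hld : l ≤ d) (Y : Matrix (Fin l) (Fin l) ℂ) :
    padMat d Y = inclMat hld * Y * (inclMat hld)ᴴ := by
  ext i j
  have : (inclMat hld * Y * (inclMat hld)ᴴ) i j =
      star ((inclMat hld * (inclMat hld * Y)ᴴ) j i) := by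
    rw [← Matrix.conjTranspose_apply, Matrix.conjTranspose_mul, Matrix.conjTranspose_conjTranspose]
  rw [this, inclMat_mul_apply]
  simp only [Matrix.conjTranspose_apply, inclMat_mul_apply, padMat, Matrix.of_apply]
  by_cases hi : (i : ℕ) < l <;> by_cases hj : (j : ℕ) < l <;> simp [hi, hj]

theorem padVec_eq (hld : l ≤ d) (u : Fin l → ℂ) : padVec d u = inclMat hld *ᵥ u := by
  ext i
  have := inclMat_mul_apply hld (Matrix.replicateCol Unit u) i ()
  exact this.symm

end Padding

/-! ### The model space `ℒ(Q)` -/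

section FunctionModel

variable {d l : ℕ} {B : Submodule ℂ (Fin d → ℂ[X])}
  {φ : B →ₗ[ℂ] B →ₗ⋆[ℂ] ℂ} {A : Submodule ℂ (B × B)} {Γ : ℂ → (Fin l → ℂ) →ₗ[ℂ] B}
  {Q : ℂ → Matrix (Fin l) (Fin l) ℂ}

/-- The map `f ↦ (z ↦ Γ_{z^*}^* f)` of `𝔅` onto `ℒ(Q)`. -/
noncomputable def toModel (φ : B →ₗ[ℂ] B →ₗ⋆[ℂ] ℂ) (Γ : ℂ → (Fin l → ℂ) →ₗ[ℂ] B) (Ω : Set ℂ) :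
    B →ₗ[ℂ] (Ω → Fin l → ℂ) :=
  LinearMap.pi fun z => adjVec φ (Γ (conj (z : ℂ)))

/-- The form of `𝔅`, transported to the image of `𝔅` under an injective `toModel`. -/
noncomputable def modelForm {Ω : Set ℂ} (hinj : Function.Injective (toModel φ Γ Ω)) :
    LinearMap.range (toModel φ Γ Ω) →ₗ[ℂ] LinearMap.range (toModel φ Γ Ω) →ₗ⋆[ℂ] ℂ :=
  (φ ∘ₗ (LinearEquiv.ofInjective _ hinj).symm.toLinearMap).compl₂
    (LinearEquiv.ofInjective _ hinj).symm.toLinearMap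

theorem modelForm_apply {Ω : Set ℂ} (hinj : Function.Injective (toModel φ Γ Ω))
    (u v : LinearMap.range (toModel φ Γ Ω)) : modelForm hinj u v =
      φ ((LinearEquiv.ofInjective _ hinj).symm u) ((LinearEquiv.ofInjective _ hinj).symm v) := rfl

variable [FiniteDimensional ℂ B]

/-- The space `ℒ(Q)`: the image of `𝔅` under an injective `toModel`. -/
noncomputable abbrev modelSpace (hφ : IsPontryaginForm φ) {Ω : Set ℂ}
    (hinj : Function.Injective (toModel φ Γ Ω)) : FunctionSpace Ω l where
  carrier := LinearMap.range (toModel φ Γ Ω)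
  finiteDimensional := inferInstance
  form := modelForm hinj
  pontryagin :=
    { hermitian := fun _ _ => hφ.hermitian _ _
      nondegenerate := fun f hf => by
        rw [← (LinearEquiv.ofInjective _ hinj).symm.map_eq_zero_iff]
        refine hφ.nondegenerate _ fun g => ?_
        have := hf (LinearEquiv.ofInjective _ hinj g)
        rwa [modelForm_apply, LinearEquiv.symm_apply_apply] at this }

/-- The kernel of the model is `Γ_{z^*}^* Γ_{w^*}`, which is `Γ_w^* Γ_z`. -/
theorem modelSpace_hasKernel (hφ : IsPontryaginForm φ) (hQ : IsQFunction φ (mulRel B) A Γ Q)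
    (hinj : Function.Injective (toModel φ Γ (resolventSet A))) :
    (modelSpace hφ hinj).HasKernel fun z w => defectKernel φ Γ z w := by
  intro w x
  refine ⟨LinearEquiv.ofInjective _ hinj (Γ (conj (w : ℂ)) x), fun z => ?_, fun f => ?_⟩
  · beta_reduce
    rw [← hQ.defectKernel_conj hφ z.2 w.2, defectKernel_mulVec]
    rfl
  · obtain ⟨f, rfl⟩ := (LinearEquiv.ofInjective _ hinj).surjective f
    refine Eq.trans ?_ (form_map (Γ (conj (w : ℂ))) f x)
    rw [modelForm_apply, LinearEquiv.symm_apply_apply, LinearEquiv.symm_apply_apply]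

end FunctionModel

/-! ### The pair `M`, `N` -/

section MainIdentity

variable {d l : ℕ} {B : Submodule ℂ (Fin d → ℂ[X])} [FiniteDimensional ℂ B]
  {φ : B →ₗ[ℂ] B →ₗ⋆[ℂ] ℂ} {A : Submodule ℂ (B × B)} {Γ : ℂ → (Fin l → ℂ) →ₗ[ℂ] B}
  {Q : ℂ → Matrix (Fin l) (Fin l) ℂ}

/-- On `ρ(A)` both sides equal `(z - w^*) N₁(z) Γ_w^* Γ_z N₁(w)^*`, where `N₁` consists of the first
`l` columns of `N`. -/
theorem kernel_identity_of_mem_resolventSet (hφ : IsPontryaginForm φ)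
    (hQ : IsQFunction φ (mulRel B) A Γ Q) (hld : l ≤ d) {M N : Matrix (Fin d) (Fin d) ℂ[X]}
    (hN : ∀ z ∈ resolventSet A, ∀ f : B, evalVec z (f : Fin d → ℂ[X]) =
      (evalMat N z * inclMat hld) *ᵥ adjVec φ (Γ (conj z)) f)
    (hM : ∀ z ∈ resolventSet A, evalMat M z = evalMat N z * padMat d (Q z))
    {z w : ℂ} (hz : z ∈ resolventSet A) (hw : w ∈ resolventSet A) :
    evalMat M z * (evalMat N w)ᴴ - evalMat N z * (evalMat M w)ᴴ =
      (z - conj w) • reproKernel hφ z w := by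
  have hadj : ∀ x, evalAdj hφ w x = Γ (conj w) ((evalMat N w * inclMat hld)ᴴ *ᵥ x) := by
    intro x
    refine hφ.eq_of_forall_right fun f => ?_
    rw [form_evalAdj, form_map, hN w hw, Matrix.star_mulVec, Matrix.conjTranspose_conjTranspose,
      Matrix.dotProduct_mulVec]
  have hK : reproKernel hφ z w = (evalMat N z * inclMat hld) * defectKernel φ Γ z w *
      (evalMat N w * inclMat hld)ᴴ := by
    refine Matrix.ext_of_mulVec_single fun j => ?_
    rw [reproKernel_mulVec, hN z hz, hadj, ← defectKernel_mulVec, hQ.defectKernel_conj hφ hz hw,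
      Matrix.mulVec_mulVec, Matrix.mulVec_mulVec]
  rw [hK, ← Matrix.smul_mul, ← Matrix.mul_smul, ← hQ.kernel_eq z hz w hw, hM z hz, hM w hw,
    padMat_eq hld, padMat_eq hld]
  simp only [Matrix.conjTranspose_mul, Matrix.conjTranspose_conjTranspose, Matrix.mul_assoc,
    Matrix.mul_sub, Matrix.sub_mul]

theorem rank_fromCols_eq {M N : Matrix (Fin d) (Fin d) ℂ} (h : IsUnit N.det) :
    (Matrix.fromCols M N).rank = d := by
  refine le_antisymm ((Matrix.rank_le_card_height _).trans_eq (Fintype.card_fin d)) ?_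
  have h1 : N = Matrix.fromCols M N * (Matrix.fromRows 0 1 : Matrix (Fin d ⊕ Fin d) (Fin d) ℂ) := by
    rw [Matrix.fromCols_mul_fromRows]; simp
  have h2 : N.rank = d := by
    rw [Matrix.rank_of_isUnit N ((Matrix.isUnit_iff_isUnit_det N).2 h), Fintype.card_fin]
  conv_lhs => rw [← h2, h1]
  exact Matrix.rank_mul_le_left _ _

/-- The existence of `M` and `N` for a given `Q`-function. -/
theorem exists_pair (hφ : IsPontryaginForm φ) {α : ℂ}
    (hl : Module.finrank ℂ (LinearMap.range (evalVec α ∘ₗ B.subtype)) = l) (hld : l ≤ d)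
    (hQ : IsQFunction φ (mulRel B) A Γ Q) :
    ∃ M N : Matrix (Fin d) (Fin d) ℂ[X], N.det ≠ 0 ∧
      (∀ z ∈ resolventSet A, evalMat M z = evalMat N z * padMat d (Q z)) ∧
      (∀ z ∈ resolventSet A, ∀ f : B, evalVec z (f : Fin d → ℂ[X]) =
        evalMat N z *ᵥ padVec d (adjVec φ (Γ (conj z)) f)) ∧
      ∀ z w : ℂ, evalMat M z * (evalMat N w)ᴴ - evalMat N z * (evalMat M w)ᴴ =
        (z - conj w) • reproKernel hφ z w := by
  obtain ⟨n, m, hn, hm⟩ := hQ.exists_columns hφ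
  obtain ⟨N, hdet, hNn⟩ := exists_completion hl hld hQ.finite_compl (n := n)
    fun z hz f hf => ⟨_, hn z hz ⟨f, hf⟩⟩
  let M : Matrix (Fin d) (Fin d) ℂ[X] :=
    Matrix.of fun i k => if h : (k : ℕ) < l then m ⟨k, h⟩ i else 0
  have hN1 : ∀ z i j, (evalMat N z * inclMat hld) i j = evalVec z (n j) i := by
    intro z i j
    rw [mul_inclMat_apply, evalMat_apply, hNn]; rfl
  have hN : ∀ z ∈ resolventSet A, ∀ f : B, evalVec z (f : Fin d → ℂ[X]) =
      (evalMat N z * inclMat hld) *ᵥ adjVec φ (Γ (conj z)) f := by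
    intro z hz f
    ext i
    rw [hn z hz f]
    simp [Matrix.mulVec, dotProduct, hN1, mul_comm]
  have hM : ∀ z ∈ resolventSet A, evalMat M z = evalMat N z * padMat d (Q z) := by
    intro z hz
    ext i k
    have h1 : (evalMat N z * padMat d (Q z)) i k =
        star ((inclMat hld * (evalMat N z * inclMat hld * Q z)ᴴ) k i) := by
      rw [padMat_eq hld, ← Matrix.conjTranspose_apply, Matrix.conjTranspose_mul,
        Matrix.conjTranspose_conjTranspose]
      simp only [Matrix.mul_assoc]
    rw [h1, inclMat_mul_apply, evalMat_apply]
    by_cases hk : (k : ℕ) < l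
    · have h2 := congrFun (hm z hz ⟨k, hk⟩) i
      rw [evalVec_apply] at h2
      simp only [M, Matrix.of_apply, hk, dif_pos, h2, Matrix.conjTranspose_apply, star_star,
        Matrix.mul_apply (M := evalMat N z * inclMat hld), hN1]
      simp [mul_comm]
    · simp [M, hk]
  refine ⟨M, N, hdet, hM, fun z hz f => ?_, ?_⟩
  · rw [hN z hz f, padVec_eq hld, Matrix.mulVec_mulVec]
  · have hdense : Dense (resolventSet A) := by
      have := hQ.finite_compl.countable.dense_compl ℝ
      rwa [compl_compl] at this
    exact kernel_identity_of_dense hφ hdense fun z hz w hw =>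
      kernel_identity_of_mem_resolventSet hφ hQ hld hN hM hz hw

end MainIdentity

end PolyPontryagin

theorem theorem5p1 (d : ℕ) (B : Submodule ℂ (Fin d → ℂ[X])) [FiniteDimensional ℂ B]
    (φ : B →ₗ[ℂ] B →ₗ⋆[ℂ] ℂ) (hφ : IsPontryaginForm φ)
    (hA : IsSymmetricRel φ (mulRel B))
    (hB : ∃ α : ℂ, ranSub (mulRel B) α = LinearMap.ker (evalVec α ∘ₗ B.subtype)) :
    ∃ l : ℕ, l ≤ d ∧ (B ≠ ⊥ → 1 ≤ l) ∧ HasDefectNumbers φ (mulRel B) l ∧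
      ∀ (A : Submodule ℂ (B × B)) (Γ : ℂ → (Fin l → ℂ) →ₗ[ℂ] B)
        (Q : ℂ → Matrix (Fin l) (Fin l) ℂ), IsQFunction φ (mulRel B) A Γ Q →
      ∃ M N : Matrix (Fin d) (Fin d) ℂ[X], N.det ≠ 0 ∧
        (∀ z ∈ resolventSet A, evalMat M z = evalMat N z * padMat d (Q z)) ∧
        -- `L` is `ℒ(Q)`; multiplication by `N` is a unitary map of `ℒ(Q) ⊕ {0}` onto `𝔅`
        (∃ L : FunctionSpace (resolventSet A) l,
          L.HasKernel (fun z w => defectKernel φ Γ z w) ∧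
          ∃ U : L.carrier ≃ₗ[ℂ] B, (∀ u v, φ (U u) (U v) = L.form u v) ∧
            ∀ (u : L.carrier) (z : resolventSet A),
              evalVec (z : ℂ) (U u : Fin d → ℂ[X]) =
                evalMat N z *ᵥ padVec d ((u : resolventSet A → Fin l → ℂ) z)) ∧
        (∃ κ : ℕ, HasNegativeIndex φ κ ∧ IsNevanlinnaPair M N κ) ∧
        (∃ k : ℂ → ℂ → Matrix (Fin d) (Fin d) ℂ,
          IsReproducingKernel φ (fun z : ℂ => evalVec z ∘ₗ B.subtype) k ∧
          ∀ z w : ℂ, z ≠ conj w → k z w = nevanlinnaKernel M N z w) := by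
  obtain ⟨α, hα⟩ := hB
  have hld : Module.finrank ℂ (LinearMap.range (evalVec α ∘ₗ B.subtype)) ≤ d := by
    simpa using Submodule.finrank_le (LinearMap.range (evalVec α ∘ₗ B.subtype))
  refine ⟨_, hld, one_le_finrank_range_evalVec hα, hasDefectNumbers_mulRel hφ hα,
    fun A Γ Q hQ => ?_⟩
  obtain ⟨M, N, hdet, hM, hN, hker⟩ := exists_pair hφ rfl hld hQ
  have hK : ∀ z w : ℂ, z ≠ conj w → reproKernel hφ z w = nevanlinnaKernel M N z w := by
    intro z w hzw
    rw [nevanlinnaKernel, hker, smul_smul, inv_mul_cancel₀ (sub_ne_zero.2 hzw), one_smul]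
  have hinj : Function.Injective (toModel φ Γ (resolventSet A)) := by
    rw [injective_iff_map_eq_zero]
    intro f hf
    have hinf : (resolventSet A).Infinite := by
      simpa using hQ.finite_compl.infinite_compl
    refine Subtype.ext (eq_zero_of_evalVec_eq_zero hinf fun z hz => ?_)
    have h0 : adjVec φ (Γ (conj z)) f = 0 := congrFun hf ⟨z, hz⟩
    rw [hN z hz f, h0, padVec_eq hld, Matrix.mulVec_zero, Matrix.mulVec_zero]
  refine ⟨M, N, hdet, hM, ⟨modelSpace hφ hinj, modelSpace_hasKernel hφ hQ hinj,
    (LinearEquiv.ofInjective _ hinj).symm, fun _ _ => rfl, fun u z => ?_⟩, ?_,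
    reproKernel hφ, isReproducingKernel_reproKernel hφ, hK⟩
  · obtain ⟨f, rfl⟩ := (LinearEquiv.ofInjective _ hinj).surjective u
    rw [LinearEquiv.symm_apply_apply]
    exact hN z z.2 f
  · obtain ⟨κ, hκ⟩ := exists_hasNegativeIndex φ
    refine ⟨κ, hκ, fun z => ?_, ?_, hasNegativeSquares_of_reproKernel hφ hK hκ⟩
    · rw [hker, Complex.conj_conj, sub_self, zero_smul]
    · have hroots : {z | N.det.eval z = 0}.Finite :=
        (Multiset.finite_toSet N.det.roots).subset fun z hz => (Polynomial.mem_roots hdet).2 hz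
      obtain ⟨z, hz⟩ := hroots.infinite_compl.nonempty
      refine ⟨z, rank_fromCols_eq (isUnit_iff_ne_zero.2 ?_)⟩
      rwa [← eval_det]
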